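/- Let $\kappa$ be an uncountable regular cardinal with $\kappa^{<\kappa}=\kappa$. A tree is a nonempty set of sequences closed under initial segments. A tree $T\subseteq\kappa^{<\kappa}$ is limit-closed if for every limit ordinal $\lambda<\kappa$ and every $\subseteq$-increasing sequence $\langle\sigma_\alpha:\alpha<\lambda\rangle$ from $T$ one has $\bigcup_{\alpha<\lambda}\sigma_\alpha\in T$. A short $\kappa$-Laver tree is a tree $L\subseteq\kappa^{<\omega}$ which has a stem $\mathrm{stem}(L)\in L$ (the longest node of $L$ comparable with all nodes of $L$) and in which every node $\sigma\in L$ extending $\mathrm{stem}(L)$ has exactly $\kappa$ many immediate successors, i.e. $|\{\alpha<\kappa:\sigma^\frown\langle\alpha\rangle\in L\}|=\kappa$. A pseudo-$\kappa$-Laver tree is a limit-closed tree $T\subseteq\kappa^{<\kappa}$ such that every $\sigma\in T$ has an extension $\tau\in T$ ($\sigma\subseteq\tau$) for which $\{\rho\in\kappa^{<\omega}:\tau^\frown\rho\in T\}$ is a short $\kappa$-Laver tree. Let $\mathbb{P}$ be a set of pseudo-$\kappa$-Laver trees, ordered by inclusion (smaller trees are stronger conditions), such that whenever $T\in\mathbb{P}$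 and $\sigma\in T$, also $T\uparrow\sigma:=\{\tau\in T:\sigma\subseteq\tau\text{ or }\tau\subseteq\sigma\}\in\mathbb{P}$. Then the forcing $\mathbb{P}$ adds a Cohen $\kappa$-real: there is a $\mathbb{P}$-name $\dot c$ such that every condition of $\mathbb{P}$ forces that $\dot c$ is a function from $\kappa$ to $2$ and that, for every ground model dense subset $D$ of $2^{<\kappa}$ (ordered by end-extension), some $t\in D$ is an initial segment of $\dot c$. -/

import Mathlib

open Cardinal Ordinal

universe u v v₁ w

namespace KLaver

/-! ### Transfinite sequences -/

/-- A transfinite sequence `⟨σ(i) : i < len⟩` of elements of `A`. -/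
structure TSeq (A : Type v) : Type (max (u + 1) v) where
  len : Ordinal.{u}
  val : Set.Iio len → A

namespace TSeq

variable {A : Type v}

theorem ext_of_val {σ τ : TSeq.{u} A} (h : σ.len = τ.len)
    (hv : ∀ (i : Ordinal.{u}) (hi : i < σ.len) (hj : i < τ.len),
      σ.val ⟨i, hi⟩ = τ.val ⟨i, hj⟩) : σ = τ := by
  obtain ⟨l, f⟩ := σ
  obtain ⟨m, g⟩ := τ
  obtain rfl : l = m := h
  congr 1
  funext i
  exact hv i.1 i.2 i.2

/-- `σ ≤ τ` means that `σ` is an initial segment of `τ` (`σ ⊆ τ` as functions). -/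
instance : PartialOrder (TSeq.{u} A) where
  le σ τ := σ.len ≤ τ.len ∧ ∀ (i : Ordinal.{u}) (hi : i < σ.len) (hj : i < τ.len),
    σ.val ⟨i, hi⟩ = τ.val ⟨i, hj⟩
  le_refl _ := ⟨le_rfl, fun _ _ _ => rfl⟩
  le_trans _ _ _ h₁ h₂ := ⟨h₁.1.trans h₂.1, fun i hi hj =>
    (h₁.2 i hi (hi.trans_le h₁.1)).trans (h₂.2 i (hi.trans_le h₁.1) hj)⟩
  le_antisymm _ _ h₁ h₂ := ext_of_val (le_antisymm h₁.1 h₂.1) h₁.2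

theorem le_def {σ τ : TSeq.{u} A} : σ ≤ τ ↔ σ.len ≤ τ.len ∧
    ∀ (i : Ordinal.{u}) (hi : i < σ.len) (hj : i < τ.len),
      σ.val ⟨i, hi⟩ = τ.val ⟨i, hj⟩ := Iff.rfl

/-- The sequence `⟨a⟩` of length one. -/
def single (a : A) : TSeq.{u} A := ⟨1, fun _ => a⟩

/-- The concatenation `σ ⌢ τ`. -/
noncomputable def append (σ τ : TSeq.{u} A) : TSeq.{u} A where
  len := σ.len + τ.len
  val i := if h : i.1 < σ.len then σ.val ⟨i.1, h⟩ else
    τ.val ⟨i.1 - σ.len, by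
      have h₁ : i.1 < σ.len + τ.len := i.2
      have h₂ : σ.len + (i.1 - σ.len) = i.1 := Ordinal.add_sub_cancel_of_le (not_lt.mp h)
      rw [← h₂] at h₁
      exact (add_lt_add_iff_left σ.len).mp h₁⟩

/-- `ρ` is the union of the sequences `s i`: it extends all of them, and each of its entries
already occurs in one of them. -/
def IsUnion {ι : Type w} (s : ι → TSeq.{u} A) (ρ : TSeq.{u} A) : Prop :=
  (∀ i, s i ≤ ρ) ∧ ∀ j < ρ.len, ∃ i, j < (s i).len

end TSeq

/-! ### Trees -/

section Trees

variable {A : Type v}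

/-- `T` is a tree in `A^{<δ}`: a nonempty set of sequences of length `< δ` that is closed under
initial segments. -/
structure IsTree (δ : Ordinal.{u}) (T : Set (TSeq.{u} A)) : Prop where
  nonempty : T.Nonempty
  len_lt : ∀ σ ∈ T, σ.len < δ
  mem_of_le : ∀ σ ∈ T, ∀ τ, τ ≤ σ → τ ∈ T

/-- `Succ_T(σ)`, the set of all `a` such that `σ ⌢ ⟨a⟩ ∈ T`. -/
def succSet (T : Set (TSeq.{u} A)) (σ : TSeq.{u} A) : Set A :=
  {a | σ.append (TSeq.single a) ∈ T}

/-- `s` is the stem of `T`: the longest node of `T` that is comparable with all nodes of `T`. -/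
def IsStem (T : Set (TSeq.{u} A)) (s : TSeq.{u} A) : Prop :=
  IsGreatest {s | s ∈ T ∧ ∀ τ ∈ T, s ≤ τ ∨ τ ≤ s} s

/-- `T ↑ σ`, the set of all nodes of `T` that are comparable with `σ`. -/
def restrictTo (T : Set (TSeq.{u} A)) (σ : TSeq.{u} A) : Set (TSeq.{u} A) :=
  {τ | τ ∈ T ∧ (σ ≤ τ ∨ τ ≤ σ)}

/-- The set of all finite sequences `τ` with `σ ⌢ τ ∈ T`. -/
def omegaPart (T : Set (TSeq.{u} A)) (σ : TSeq.{u} A) : Set (TSeq.{u} A) :=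
  {τ | τ.len < ω ∧ σ.append τ ∈ T}

/-- `T` is limit-closed (below `δ`): for every limit ordinal `l < δ`, the union of an increasing
sequence of length `l` of nodes of `T` is a node of `T`. -/
def IsLimitClosed (δ : Ordinal.{u}) (T : Set (TSeq.{u} A)) : Prop :=
  ∀ l : Ordinal.{u}, Order.IsSuccLimit l → l < δ →
    ∀ s : Set.Iio l → TSeq.{u} A, Monotone s → (∀ i, s i ∈ T) →
      ∀ ρ : TSeq.{u} A, TSeq.IsUnion s ρ → ρ ∈ T

end Trees

/-- `κ` as a set of ordinals. -/
abbrev Pt (κ : Cardinal.{u}) : Type (u + 1) := Set.Iio κ.ord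

/-- A short `κ`-Laver tree: a tree in `κ^{<ω}` in which every node extending the stem has
`κ` many immediate successors. -/
def IsShortLaverTree (κ : Cardinal.{u}) (L : Set (TSeq.{u} (Pt κ))) : Prop :=
  IsTree ω L ∧ ∃ s, IsStem L s ∧
    ∀ σ ∈ L, s ≤ σ → #(succSet L σ) = Cardinal.lift.{u + 1} κ

/-- A pseudo-`κ`-Laver tree: a limit-closed tree in `κ^{<κ}` such that each node `σ` has an
extension `τ` in the tree for which the finite sequences above `τ` form a short `κ`-Laver tree. -/
structure IsPseudoLaverTree (κ : Cardinal.{u}) (T : Set (TSeq.{u} (Pt κ))) : Prop where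
  isTree : IsTree κ.ord T
  limitClosed : IsLimitClosed κ.ord T
  exists_short : ∀ σ ∈ T, ∃ τ ∈ T, σ ≤ τ ∧ IsShortLaverTree κ (omegaPart T τ)

/-! ### Forcing

`P` is a forcing notion, with `q ≤ p` meaning that `q` is stronger than `p`. Statements of the
forcing language are represented by the predicates `φ : P → Prop` of forcing them. -/

section Forcing

variable {P : Type w} [Preorder P]

/-- `D` is dense below `p`. -/
def DenseBelow (D : P → Prop) (p : P) : Prop := ∀ q ≤ p, ∃ r ≤ q, D r

/-- `p ⊩ ¬ φ`: no stronger condition forces `φ`. -/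
def ForcesNot (φ : P → Prop) (p : P) : Prop := ∀ q ≤ p, ¬ φ q

/-- `p ⊩ ∃ x ∈ X̌, φ(x)` for a ground model set `X`: densely many conditions below `p` force
`φ(x)` for some `x ∈ X`. -/
def ForcesExists {α : Type v} (X : Set α) (φ : α → P → Prop) (p : P) : Prop :=
  DenseBelow (fun r => ∃ x ∈ X, φ x r) p

/-- A `P`-name for a subset of the ground model set `X`, i.e. a name of the form
`{(x̌, p) : (x, p) ∈ N}`. Every subset of `X` in a generic extension has such a name. A generic
filter `G` evaluates it to `{x : ∃ p ∈ G, (x, p) ∈ N}`. -/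
abbrev SubsetName (X : Type v) (P : Type w) := Set (X × P)

/-- `p ⊩ x̌ ∈ N`. -/
def ForcesMem {X : Type v} (N : SubsetName X P) (x : X) (p : P) : Prop :=
  DenseBelow (fun r => ∃ s, (x, s) ∈ N ∧ r ≤ s) p

/-- `p ⊩ N is a function from X̌ to Y̌`, for a name `N` for a subset of `X × Y`. -/
def ForcesFunction {X : Type v} {Y : Type v₁} (N : SubsetName (X × Y) P) (p : P) : Prop :=
  (∀ x : X, ForcesExists Set.univ (fun y : Y => ForcesMem N (x, y)) p) ∧
    ∀ (x : X) (y z : Y), y ≠ z →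
      ForcesNot (fun q => ForcesMem N (x, y) q ∧ ForcesMem N (x, z) q) p

/-- The underlying set of `κ`-Cohen forcing: the set `2^{<κ}`, ordered by extension. -/
def cohenForcing (κ : Cardinal.{u}) : Set (TSeq.{u} Bool) :=
  {t | t.len < κ.ord}

/-- `D` is a dense set of conditions of `κ`-Cohen forcing. -/
def IsCohenDense (κ : Cardinal.{u}) (D : Set (TSeq.{u} Bool)) : Prop :=
  D ⊆ cohenForcing κ ∧ ∀ s ∈ cohenForcing κ, ∃ t ∈ D, s ≤ t

/-- `p ⊩ ť ⊆ N`, for `t ∈ 2^{<κ}` and a name `N` for a subset of `κ × 2`. -/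
def ForcesInitial (κ : Cardinal.{u}) (N : SubsetName (Pt κ × Bool) P)
    (t : TSeq.{u} Bool) (p : P) : Prop :=
  ∀ (i : Pt κ) (hi : i.1 < t.len), ForcesMem N (i, t.val ⟨i.1, hi⟩) p

/-- `p ⊩ N is a Cohen κ-real over the ground model`: `p` forces that `N` is a function from `κ`
to `2`, and that for each ground model dense subset `D` of `κ`-Cohen forcing there is some `t ∈ D`
with `t ⊆ N`. -/
def ForcesCohenReal (κ : Cardinal.{u}) (N : SubsetName (Pt κ × Bool) P)
    (p : P) : Prop :=
  ForcesFunction N p ∧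
    ∀ D : Set (TSeq.{u} Bool), IsCohenDense κ D →
      ForcesExists D (fun t => ForcesInitial κ N t) p

/-- The forcing notion `P` adds a Cohen `κ`-real: there is a `P`-name that is forced by all
conditions to be a Cohen `κ`-real over the ground model. -/
def AddsCohenReal (κ : Cardinal.{u}) (P : Type w) [Preorder P] : Prop :=
  ∃ N : SubsetName (Pt κ × Bool) P, ∀ p : P, ForcesCohenReal κ N p

end Forcing

end KLaver

/-! The Cohen real is read off the limit points of the nodes. Fix `h` from ordinals to `2^{<κ}` that
takes each value stationarily often at ordinals of countable cofinality. When the entries of a node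
converge strictly from below to `α`, the word `h α` is revealed; bit `i` comes from the first
revealed word with an `i`-th bit.

Let `T` be a condition and `D` a dense set. Take `τ ∈ T` above which `T` splits `κ` many ways for
`ω` steps, collect what `τ` decodes into a condition `s`, and extend `s` to some `t ∈ D`. Finite
choices above `τ` are bounded by a function `f` on `κ`. Guessing gives a closure point `α` of `f`
with `h α = t`, and a branch of `ω` further steps can be steered to converge to `α`. By
limit-closure its union `U` lies in `T`; it reveals just one new word, `t`, so all of `t` is decoded
and `T ↑ U` forces `t` to be an initial segment.

The main lemmas are `exists_isGuessing`, `decode_of_isLim_len`, `exists_branch` and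
`IsPseudoLaverTree.exists_decode_mem`. -/

namespace KLaver

/-! ### Guessing at closure points of countable cofinality -/

/-- `a` is a sequence of ordinals below `α` that is cofinal in `α`. -/
def IsLadder (a : ℕ → Ordinal.{u}) (α : Ordinal.{u}) : Prop :=
  (∀ n, a n < α) ∧ ∀ γ < α, ∃ n, γ ≤ a n

theorem exists_lt_ord_forall_lt {κ : Cardinal.{u}} (hreg : κ.IsRegular) {ι : Type v}
    (hι : Cardinal.lift.{u} #ι < Cardinal.lift.{v} κ) {f : ι → Ordinal.{u}}
    (hf : ∀ i, f i < κ.ord) : ∃ b < κ.ord, ∀ i, f i < b := by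
  have hs : Small.{u} ι := by
    obtain ⟨c, hc⟩ := Cardinal.mem_range_lift_of_le hι.le
    have h := Cardinal.lift_mk_eq'.{v, u}.1 (show Cardinal.lift.{u} #ι = Cardinal.lift.{v} #c.out by
      rw [Cardinal.mk_out, hc])
    exact ⟨c.out, h⟩
  refine ⟨⨆ i, f i + 1, Ordinal.lift_iSup_add_one_lt_of_lt_cof ?_ hf, fun i => ?_⟩
  · rwa [← Ordinal.lift_cof, hreg.cof_ord]
  · exact Ordinal.lt_iSup_add_one f i

theorem exists_lt_ord_forall_Iio {κ : Cardinal.{u}} (hreg : κ.IsRegular)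
    {f : Ordinal.{u} → Ordinal.{u}} (hf : ∀ β < κ.ord, f β < κ.ord) {β : Ordinal.{u}}
    (hβ : β < κ.ord) : ∃ b < κ.ord, ∀ γ < β, f γ < b := by
  obtain ⟨b, hb, h⟩ := exists_lt_ord_forall_lt hreg (ι := Set.Iio β) (f := fun γ => f γ.1)
    (by
      rw [Cardinal.mk_Iio_ordinal, Cardinal.lift_lift, Cardinal.lift_lt]
      exact Cardinal.lt_ord.1 hβ)
    (fun γ => hf _ (γ.2.trans hβ))
  exact ⟨b, hb, fun γ hγ => h ⟨γ, hγ⟩⟩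

theorem exists_lt_ord_forall_nat {κ : Cardinal.{u}} (hreg : κ.IsRegular)
    (hunc : Cardinal.aleph0 < κ) {f : ℕ → Ordinal.{u}} (hf : ∀ n, f n < κ.ord) :
    ∃ b < κ.ord, ∀ n, f n < b :=
  exists_lt_ord_forall_lt hreg (by simpa using hunc) hf

theorem add_one_lt_ord {κ : Cardinal.{u}} (hreg : κ.IsRegular) {β : Ordinal.{u}}
    (hβ : β < κ.ord) : β + 1 < κ.ord :=
  (Cardinal.isSuccLimit_ord hreg.aleph0_le).add_one_lt hβ

/-- Iterating a bounding function `ω` times yields a chain that is itself a ladder for its supremum;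
as `κ` is regular and uncountable, this supremum stays below `κ`. -/
theorem exists_closed_ladder {κ : Cardinal.{u}} (hreg : κ.IsRegular)
    (hunc : Cardinal.aleph0 < κ) {f : Ordinal.{u} → Ordinal.{u}}
    (hf : ∀ β < κ.ord, f β < κ.ord) {η : Ordinal.{u}} (hη : η < κ.ord) :
    ∃ α < κ.ord, η < α ∧ (∀ β < α, f β < α) ∧ ∃ a, IsLadder a α := by
  have hstep : ∀ β : Set.Iio κ.ord, ∃ γ : Set.Iio κ.ord, β < γ ∧ ∀ δ ≤ β.1, f δ < γ := by
    intro β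
    obtain ⟨b, hb, h⟩ := exists_lt_ord_forall_Iio hreg hf (add_one_lt_ord hreg β.2)
    refine ⟨⟨max b (β + 1), max_lt hb (add_one_lt_ord hreg β.2)⟩, ?_, fun δ hδ => ?_⟩
    · exact Subtype.coe_lt_coe.1 (lt_max_of_lt_right (lt_add_one β.1))
    · exact lt_max_of_lt_left (h δ (Order.lt_add_one_iff.2 hδ))
  choose g hg₁ hg₂ using hstep
  let c : ℕ → Set.Iio κ.ord := fun n => g^[n] ⟨η, hη⟩
  have hc : ∀ n, c (n + 1) = g (c n) := fun n => Function.iterate_succ_apply' _ _ _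
  have hlt : ∀ n, (c n).1 < (c (n + 1)).1 := fun n => by
    rw [hc]
    exact hg₁ (c n)
  obtain ⟨b, hb, hcb⟩ := exists_lt_ord_forall_nat hreg hunc (f := fun n => (c n).1)
    fun n => (c n).2
  have hbdd : BddAbove (Set.range fun n => (c n).1) := ⟨b, by
    rintro _ ⟨n, rfl⟩
    exact (hcb n).le⟩
  have hmem : ∀ n, (c n).1 < ⨆ n, (c n).1 := fun n => (hlt n).trans_le (le_ciSup hbdd (n + 1))
  refine ⟨⨆ n, (c n).1, (ciSup_le fun n => (hcb n).le).trans_lt hb, hmem 0, fun β hβ => ?_,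
    fun n => (c n).1, hmem, fun γ hγ => ?_⟩
  · obtain ⟨n, hn⟩ := exists_lt_of_lt_ciSup hβ
    refine lt_trans ?_ (hmem (n + 1))
    rw [hc]
    exact hg₂ (c n) β hn.le
  · obtain ⟨n, hn⟩ := exists_lt_of_lt_ciSup hγ
    exact ⟨n, hn.le⟩

/-- `S` is stationary in `κ`: it meets the set of closure points of each `f : κ → κ`. -/
def IsStat (κ : Cardinal.{u}) (S : Set Ordinal.{u}) : Prop :=
  ∀ f : Ordinal.{u} → Ordinal.{u}, (∀ β < κ.ord, f β < κ.ord) →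
    ∃ α ∈ S, α < κ.ord ∧ ∀ β < α, f β < α

/-- Pressing down for a single regressive function. -/
theorem exists_isStat_fiber {κ : Cardinal.{u}} (hreg : κ.IsRegular) {S : Set Ordinal.{u}}
    (hS : IsStat κ S) {r : Ordinal.{u} → Ordinal.{u}} (hr : ∀ α ∈ S, r α < α) :
    ∃ γ < κ.ord, IsStat κ {α ∈ S | r α = γ} := by
  by_contra! hcon
  have hcon' : ∀ γ : Ordinal.{u}, ∃ f : Ordinal.{u} → Ordinal.{u}, γ < κ.ord →
      (∀ β < κ.ord, f β < κ.ord) ∧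
      ∀ α ∈ S, r α = γ → α < κ.ord → ∃ β < α, α ≤ f β := by
    intro γ
    by_cases hγ : γ < κ.ord
    · have h := hcon γ hγ
      unfold IsStat at h
      push Not at h
      obtain ⟨f, hf, h⟩ := h
      exact ⟨f, fun _ => ⟨hf, fun α hα hrα hακ => h α ⟨hα, hrα⟩ hακ⟩⟩
    · exact ⟨id, fun h => absurd h hγ⟩
  choose F hF using hcon'
  -- Diagonal intersection: a closure point `α` of the resulting `G` is closed under `F γ` for every
  -- `γ < α`, in particular for `γ = r α`.
  have hb : ∀ β : Ordinal.{u}, ∃ b : Ordinal.{u}, β < κ.ord → b < κ.ord ∧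
      ∀ γ ≤ β, ∀ δ ≤ β, F γ δ < b := by
    intro β
    by_cases hβ : β < κ.ord
    · have h₁ : ∀ γ : Ordinal.{u}, ∃ b : Ordinal.{u}, γ < κ.ord → b < κ.ord ∧
          ∀ δ < β + 1, F γ δ < b := by
        intro γ
        by_cases hγ : γ < κ.ord
        · obtain ⟨b, hb, h⟩ := exists_lt_ord_forall_Iio hreg (hF γ hγ).1 (add_one_lt_ord hreg hβ)
          exact ⟨b, fun _ => ⟨hb, h⟩⟩
        · exact ⟨0, fun h => absurd h hγ⟩
      choose B hB using h₁
      obtain ⟨b, hb, h⟩ := exists_lt_ord_forall_Iio hreg (fun γ hγ => (hB γ hγ).1)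
        (add_one_lt_ord hreg hβ)
      exact ⟨b, fun _ => ⟨hb, fun γ hγ δ hδ =>
        ((hB γ (hγ.trans_lt hβ)).2 δ (Order.lt_add_one_iff.2 hδ)).trans
          (h γ (Order.lt_add_one_iff.2 hγ))⟩⟩
    · exact ⟨0, fun h => absurd h hβ⟩
  choose G hG using hb
  obtain ⟨α, hαS, hακ, hα⟩ := hS G fun β hβ => (hG β hβ).1
  have hrα := hr α hαS
  obtain ⟨β, hβα, hle⟩ := (hF (r α) (hrα.trans hακ)).2 α hαS rfl hακ
  have hm : max (r α) β < α := max_lt hrα hβα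
  exact (hα _ hm).not_ge (hle.trans ((hG _ (hm.trans hακ)).2 _ (le_max_left _ _) _
    (le_max_right _ _)).le)

/-- There is a function on `κ` that takes `κ` many values on stationary sets of ordinals of
countable cofinality. -/
theorem exists_unbounded_isStat_fiber {κ : Cardinal.{u}} (hreg : κ.IsRegular)
    (hunc : Cardinal.aleph0 < κ) :
    ∃ r : Ordinal.{u} → Ordinal.{u}, ∀ η < κ.ord, ∃ γ < κ.ord, η ≤ γ ∧
      IsStat κ {α | (∃ a, IsLadder a α) ∧ r α = γ} := by
  have hlad : ∀ α : Ordinal.{u}, ∃ a : ℕ → Ordinal.{u}, (∃ a, IsLadder a α) → IsLadder a α := by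
    intro α
    by_cases h : ∃ a, IsLadder a α
    · exact ⟨h.choose, fun _ => h.choose_spec⟩
    · exact ⟨fun _ => 0, fun h' => absurd h' h⟩
  choose a ha using hlad
  -- One index `n` serves all `η`. Otherwise a common closure point above all the bad `η n` has a
  -- ladder, one of whose terms passes them all, contradicting the failure at that index.
  have hn : ∃ n, ∀ η < κ.ord, IsStat κ {α | (∃ a, IsLadder a α) ∧ η ≤ a α n} := by
    by_contra! hcon
    choose η hη hns using hcon
    unfold IsStat at hns
    push Not at hns
    choose f hf hnf using hns
    obtain ⟨e, he, heη⟩ := exists_lt_ord_forall_nat hreg hunc hη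
    have hg : ∀ β : Ordinal.{u}, ∃ b : Ordinal.{u}, β < κ.ord → b < κ.ord ∧ ∀ n, f n β < b := by
      intro β
      by_cases hβ : β < κ.ord
      · obtain ⟨b, hb, h⟩ := exists_lt_ord_forall_nat hreg hunc fun n => hf n β hβ
        exact ⟨b, fun _ => ⟨hb, h⟩⟩
      · exact ⟨0, fun h => absurd h hβ⟩
    choose g hg using hg
    obtain ⟨α, hακ, heα, hα, hlα⟩ := exists_closed_ladder hreg hunc (fun β hβ => (hg β hβ).1) he
    obtain ⟨n, hn⟩ := (ha α hlα).2 e heα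
    obtain ⟨β, hβα, hle⟩ := hnf n α ⟨hlα, (heη n).le.trans hn⟩ hακ
    exact (hle.trans_lt ((hg β (hβα.trans hακ)).2 n)).not_ge (hα β hβα).le
  obtain ⟨n, hn⟩ := hn
  refine ⟨fun α => a α n, fun η hη => ?_⟩
  obtain ⟨γ, hγ, hst⟩ := exists_isStat_fiber hreg (hn η hη) (r := fun α => a α n)
    fun α hα => (ha α hα.1).1 n
  -- Only a member of the fibre is needed, to see that `η ≤ γ`.
  obtain ⟨α, hα, -⟩ := hst id fun _ h => h
  refine ⟨γ, hγ, hα.1.2.trans_eq hα.2, fun f hf => ?_⟩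
  obtain ⟨α, hα, h⟩ := hst f hf
  exact ⟨α, ⟨hα.1.1, hα.2⟩, h⟩

/-- This is where `κ^{<κ} = κ` enters. -/
theorem mk_cohenForcing_le {κ : Cardinal.{u}} (hreg : κ.IsRegular)
    (hpow : Cardinal.powerlt κ κ = κ) : #(cohenForcing κ) ≤ Cardinal.lift.{u + 1} κ := by
  have hκ := hreg.aleph0_le
  let e : cohenForcing κ → Σ l : Set.Iio κ.ord, (Set.Iio l.1 → Bool) :=
    fun t => ⟨⟨t.1.len, t.2⟩, t.1.val⟩
  have he : Function.Injective e := by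
    rintro ⟨⟨l, f⟩, hl⟩ ⟨⟨m, g⟩, hm⟩ h
    simp only [e, Sigma.mk.injEq] at h
    obtain ⟨h₁, h⟩ := h
    obtain rfl : l = m := congrArg Subtype.val h₁
    cases h
    rfl
  refine (Cardinal.mk_le_of_injective he).trans ?_
  rw [Cardinal.mk_sigma]
  refine (Cardinal.sum_le_mk_mul_iSup _).trans ?_
  rw [Cardinal.mk_Iio_ordinal, Cardinal.card_ord]
  refine le_trans (mul_le_mul_right (a := Cardinal.lift.{u + 1} κ) (ciSup_le' fun l => ?_))
    (Cardinal.mul_eq_self (by simpa using hκ)).le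
  have h2 : (2 : Cardinal.{u}) ≤ κ := (Cardinal.natCast_lt_aleph0 (n := 2)).le.trans hκ
  have : (2 : Cardinal.{u}) ^ l.1.card ≤ κ := by
    calc (2 : Cardinal.{u}) ^ l.1.card ≤ κ ^ l.1.card := Cardinal.power_le_power_right h2
      _ ≤ κ ^< κ := Cardinal.le_powerlt _ (Cardinal.lt_ord.1 l.2)
      _ = κ := hpow
  calc #(Set.Iio l.1 → Bool) = Cardinal.lift.{u + 1} ((2 : Cardinal.{u}) ^ l.1.card) := by
        simp [Cardinal.mk_Iio_ordinal]
    _ ≤ _ := Cardinal.lift_le.2 this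

/-- `h` guesses each condition of `κ`-Cohen forcing at closure points of countable cofinality. -/
structure IsGuessing (κ : Cardinal.{u}) (h : Ordinal.{u} → TSeq.{u} Bool) : Prop where
  len_lt : ∀ α, (h α).len < κ.ord
  isStat : ∀ t ∈ cohenForcing κ, IsStat κ {α | (∃ a, IsLadder a α) ∧ h α = t}

/-- By regularity the unboundedly many stationary fibres number at least `κ`, so `2^{<κ}` injects
into them; `h` inverts this injection along `r`. -/
theorem exists_isGuessing {κ : Cardinal.{u}} (hreg : κ.IsRegular)
    (hunc : Cardinal.aleph0 < κ) (hpow : Cardinal.powerlt κ κ = κ) :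
    ∃ h, IsGuessing κ h := by
  classical
  obtain ⟨r, hr⟩ := exists_unbounded_isStat_fiber hreg hunc
  let Γ : Set Ordinal.{u} := {γ | γ < κ.ord ∧ IsStat κ {α | (∃ a, IsLadder a α) ∧ r α = γ}}
  have hΓ : Cardinal.lift.{u + 1} κ ≤ #Γ := by
    by_contra! hlt
    obtain ⟨b, hb, h⟩ := exists_lt_ord_forall_lt hreg (ι := Γ) (f := fun γ => γ.1)
      (by rwa [Cardinal.lift_id'.{u, u + 1}]) fun γ => γ.2.1
    obtain ⟨γ, hγ, hle, hst⟩ := hr b hb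
    exact (h ⟨γ, hγ, hst⟩).not_ge hle
  obtain ⟨j⟩ := (mk_cohenForcing_le hreg hpow).trans hΓ
  have hne : ∃ t : TSeq.{u} Bool, t ∈ cohenForcing κ :=
    ⟨⟨0, fun i => absurd i.2 (by simp)⟩, hreg.ord_pos⟩
  obtain ⟨t₀, ht₀⟩ := hne
  have : Nonempty (cohenForcing κ) := ⟨⟨t₀, ht₀⟩⟩
  refine ⟨fun α => if hα : r α ∈ Γ then (Function.invFun j ⟨r α, hα⟩).1 else t₀, fun α => ?_,
    fun t ht f hf => ?_⟩
  · split_ifs with hα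
    · exact (Function.invFun j ⟨r α, hα⟩).2
    · exact ht₀
  · obtain ⟨α, ⟨hl, hα⟩, h⟩ := (j ⟨t, ht⟩).2.2 f hf
    refine ⟨α, ⟨hl, ?_⟩, h⟩
    have hm : r α ∈ Γ := hα ▸ (j ⟨t, ht⟩).2
    have hj : (⟨r α, hm⟩ : Γ) = j ⟨t, ht⟩ := Subtype.ext hα
    rw [dif_pos hm, hj, Function.leftInverse_invFun j.injective]

/-! ### Decoding a binary sequence from a node -/

section Decode

variable {κ : Cardinal.{u}}

/-- The entries of `σ` converge to `α` strictly from below at `μ`. -/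
def IsLim (σ : TSeq.{u} (Pt κ)) (μ α : Ordinal.{u}) : Prop :=
  μ ≤ σ.len ∧
    (∀ γ < α, ∃ l < μ, ∀ (i : Ordinal.{u}) (hi : i < σ.len), l ≤ i → i < μ →
      γ < (σ.val ⟨i, hi⟩).1) ∧
    ∃ l < μ, ∀ (i : Ordinal.{u}) (hi : i < σ.len), l ≤ i → i < μ → (σ.val ⟨i, hi⟩).1 < α

theorem IsLim.limit_not_lt {σ : TSeq.{u} (Pt κ)} {μ α α' : Ordinal.{u}} (h : IsLim σ μ α)
    (h' : IsLim σ μ α') : ¬ α < α' := by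
  intro hlt
  obtain ⟨l, hl, h₁⟩ := h.2.2
  obtain ⟨l', hl', h₂⟩ := h'.2.1 α hlt
  have hm := max_lt hl hl'
  exact (h₁ _ (hm.trans_le h.1) (le_max_left _ _) hm).not_gt
    (h₂ _ (hm.trans_le h.1) (le_max_right _ _) hm)

theorem IsLim.unique {σ : TSeq.{u} (Pt κ)} {μ α α' : Ordinal.{u}} (h : IsLim σ μ α)
    (h' : IsLim σ μ α') : α = α' :=
  le_antisymm (not_lt.1 (h'.limit_not_lt h)) (not_lt.1 (h.limit_not_lt h'))

theorem isLim_iff_of_le {σ τ : TSeq.{u} (Pt κ)} (hle : σ ≤ τ) {μ α : Ordinal.{u}}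
    (hμ : μ ≤ σ.len) : IsLim τ μ α ↔ IsLim σ μ α := by
  constructor
  · rintro ⟨-, h₁, l, hl, h₂⟩
    refine ⟨hμ, fun γ hγ => ?_, l, hl, fun i hi hli hiμ => ?_⟩
    · obtain ⟨l, hl, h⟩ := h₁ γ hγ
      refine ⟨l, hl, fun i hi hli hiμ => ?_⟩
      rw [hle.2 i hi (hi.trans_le hle.1)]
      exact h i _ hli hiμ
    · rw [hle.2 i hi (hi.trans_le hle.1)]
      exact h₂ i _ hli hiμ
  · rintro ⟨-, h₁, l, hl, h₂⟩
    refine ⟨hμ.trans hle.1, fun γ hγ => ?_, l, hl, fun i hi hli hiμ => ?_⟩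
    · obtain ⟨l, hl, h⟩ := h₁ γ hγ
      refine ⟨l, hl, fun i hi hli hiμ => ?_⟩
      rw [← hle.2 i (hiμ.trans_le hμ) hi]
      exact h i _ hli hiμ
    · rw [← hle.2 i (hiμ.trans_le hμ) hi]
      exact h₂ i _ hli hiμ

/-- The last entry would be below `α` and hence would eventually have to be exceeded, also by
itself. -/
theorem not_isLim_add_one (σ : TSeq.{u} (Pt κ)) (l α : Ordinal.{u}) : ¬ IsLim σ (l + 1) α := by
  rintro ⟨hle, h₁, m, hm, h₂⟩
  have hl : l < σ.len := (lt_add_one l).trans_le hle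
  obtain ⟨m', hm', h₃⟩ := h₁ _ (h₂ l hl (Order.lt_add_one_iff.1 hm) (lt_add_one l))
  exact (h₃ l hl (Order.lt_add_one_iff.1 hm') (lt_add_one l)).false

variable (h : Ordinal.{u} → TSeq.{u} Bool)

/-- `b` is the `i`-th bit of the binary sequence decoded from `σ`: it is the `i`-th bit of `h α`
for the first limit `α` of entries of `σ` at which `h α` has an `i`-th bit. -/
def Decode (σ : TSeq.{u} (Pt κ)) (i : Ordinal.{u}) (b : Bool) : Prop :=
  ∃ μ α, IsLim σ μ α ∧ (∃ hi : i < (h α).len, (h α).val ⟨i, hi⟩ = b) ∧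
    ∀ μ' < μ, ∀ α', IsLim σ μ' α' → (h α').len ≤ i

variable {h}

theorem Decode.mono {σ τ : TSeq.{u} (Pt κ)} (hle : σ ≤ τ) {i : Ordinal.{u}} {b : Bool}
    (hd : Decode h σ i b) : Decode h τ i b := by
  obtain ⟨μ, α, hα, hb, hmin⟩ := hd
  exact ⟨μ, α, (isLim_iff_of_le hle hα.1).2 hα, hb, fun μ' hμ' α' hα' =>
    hmin μ' hμ' α' ((isLim_iff_of_le hle (hμ'.le.trans hα.1)).1 hα')⟩

theorem Decode.unique {σ : TSeq.{u} (Pt κ)} {i : Ordinal.{u}} {b b' : Bool}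
    (hd : Decode h σ i b) (hd' : Decode h σ i b') : b = b' := by
  obtain ⟨μ, α, hα, ⟨hi, rfl⟩, hmin⟩ := hd
  obtain ⟨μ', α', hα', ⟨hi', rfl⟩, hmin'⟩ := hd'
  obtain hlt | rfl | hlt := lt_trichotomy μ μ'
  · exact absurd (hmin' μ hlt α hα) hi.not_ge
  · obtain rfl := hα.unique hα'
    rfl
  · exact absurd (hmin μ' hlt α' hα') hi'.not_ge

theorem exists_decode_of_isLim {σ : TSeq.{u} (Pt κ)} {μ α i : Ordinal.{u}} (hα : IsLim σ μ α)
    (hi : i < (h α).len) : ∃ b, Decode h σ i b := by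
  have hex : ∃ μ : Ordinal.{u}, ∃ α, IsLim σ μ α ∧ i < (h α).len := ⟨μ, α, hα, hi⟩
  obtain ⟨μ, ⟨α, hα, hi⟩, hmin⟩ := WellFounded.has_min (wellFounded_lt (α := Ordinal.{u}))
    {μ | ∃ α, IsLim σ μ α ∧ i < (h α).len} hex
  exact ⟨_, μ, α, hα, ⟨hi, rfl⟩, fun μ' hμ' α' hα' =>
    not_lt.1 fun hlt => hmin μ' ⟨α', hα', hlt⟩ hμ'⟩

/-- Each position has at most one limit, so fewer than `κ` words are revealed and their lengths are
bounded below `κ`. -/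
theorem exists_decoded_bound (hreg : κ.IsRegular) (hh : ∀ α, (h α).len < κ.ord)
    {σ : TSeq.{u} (Pt κ)} (hσ : σ.len < κ.ord) :
    ∃ s ∈ cohenForcing κ,
      (∀ (i : Ordinal.{u}) (hi : i < s.len) (b : Bool), Decode h σ i b → s.val ⟨i, hi⟩ = b) ∧
      ∀ μ α, IsLim σ μ α → (h α).len ≤ s.len := by
  classical
  have hex : ∀ μ : Ordinal.{u}, ∃ l < κ.ord, ∀ α, IsLim σ μ α → (h α).len = l := by
    intro μ
    by_cases hμ : ∃ α, IsLim σ μ α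
    · obtain ⟨α, hα⟩ := hμ
      refine ⟨_, hh α, fun α' hα' => ?_⟩
      rw [hα'.unique hα]
    · exact ⟨0, hreg.ord_pos, fun α hα => absurd ⟨α, hα⟩ hμ⟩
  choose l hl hl' using hex
  obtain ⟨b, hb, hlb⟩ := exists_lt_ord_forall_Iio hreg (fun β _ => hl β)
    (add_one_lt_ord hreg hσ)
  -- Bits not decoded from `σ` default to `false`; this is harmless, since only decoded bits must be
  -- respected.
  refine ⟨⟨b, fun i => decide (Decode h σ i.1 true)⟩, hb, fun i hi c hc => ?_, fun μ α hα => ?_⟩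
  · cases c with
    | true => exact decide_eq_true hc
    | false => exact decide_eq_false fun ht => Bool.noConfusion (ht.unique hc)
  · rw [hl' μ α hα]
    exact (hlb μ (Order.lt_add_one_iff.2 hα.1)).le

/-- A bit already revealed in `σ` agrees with `s`, hence with `h α`. Any other bit is first revealed
at the end of `τ`, as no limits occur strictly between. -/
theorem decode_of_isLim_len {σ τ : TSeq.{u} (Pt κ)} (hle : σ ≤ τ) {s : TSeq.{u} Bool}
    (hs : ∀ (i : Ordinal.{u}) (hi : i < s.len) (b : Bool), Decode h σ i b → s.val ⟨i, hi⟩ = b)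
    (hs' : ∀ μ α, IsLim σ μ α → (h α).len ≤ s.len)
    {α : Ordinal.{u}} (hα : IsLim τ τ.len α) (hsα : s ≤ h α)
    (hno : ∀ μ α', σ.len < μ → μ < τ.len → ¬ IsLim τ μ α')
    (i : Ordinal.{u}) (hi : i < (h α).len) : Decode h τ i ((h α).val ⟨i, hi⟩) := by
  by_cases hex : ∃ μ α', IsLim σ μ α' ∧ i < (h α').len
  · obtain ⟨μ, α', hα', hi'⟩ := hex
    obtain ⟨b, hb⟩ := exists_decode_of_isLim hα' hi'
    have his : i < s.len := hi'.trans_le (hs' μ α' hα')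
    rw [← hsα.2 i his hi, hs i his b hb]
    exact hb.mono hle
  · push Not at hex
    refine ⟨τ.len, α, hα, ⟨hi, rfl⟩, fun μ hμ α' hα' => ?_⟩
    obtain hle' | hlt := le_or_gt μ σ.len
    · exact hex μ α' ((isLim_iff_of_le hle hle').1 hα')
    · exact absurd hα' (hno μ α' hlt hμ)

end Decode

/-! ### Concatenations and unions -/

namespace TSeq

variable {A : Type v}

theorem append_val_of_lt (σ τ : TSeq.{u} A) {i : Ordinal.{u}} (hi : i < σ.len)
    (hi' : i < (σ.append τ).len) : (σ.append τ).val ⟨i, hi'⟩ = σ.val ⟨i, hi⟩ :=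
  dif_pos hi

theorem append_val_of_eq_add (σ τ : TSeq.{u} A) {i j : Ordinal.{u}} (hij : i = σ.len + j)
    (hj : j < τ.len) (hi : i < (σ.append τ).len) :
    (σ.append τ).val ⟨i, hi⟩ = τ.val ⟨j, hj⟩ := by
  subst hij
  have hn : ¬ σ.len + j < σ.len := not_lt.2 le_self_add
  refine (dif_neg hn).trans ?_
  congr 2
  exact Ordinal.add_sub_cancel _ _

theorem append_val_add (σ τ : TSeq.{u} A) {j : Ordinal.{u}} (hj : j < τ.len)
    (hi : σ.len + j < (σ.append τ).len) : (σ.append τ).val ⟨σ.len + j, hi⟩ = τ.val ⟨j, hj⟩ :=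
  append_val_of_eq_add σ τ rfl hj hi

theorem le_append (σ τ : TSeq.{u} A) : σ ≤ σ.append τ :=
  ⟨le_self_add, fun _ hi hj => (append_val_of_lt σ τ hi hj).symm⟩

theorem append_le_append (σ : TSeq.{u} A) {ρ τ : TSeq.{u} A} (h : ρ ≤ τ) :
    σ.append ρ ≤ σ.append τ := by
  refine ⟨add_le_add_right h.1 σ.len, fun i hi hj => ?_⟩
  obtain hlt | hle := lt_or_ge i σ.len
  · rw [append_val_of_lt _ _ hlt, append_val_of_lt _ _ hlt]
  · obtain ⟨j, rfl⟩ := exists_add_of_le hle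
    have hj₁ : j < ρ.len := (add_lt_add_iff_left σ.len).1 hi
    rw [append_val_add _ _ hj₁, append_val_add _ _ (hj₁.trans_le h.1)]
    exact h.2 _ _ _

theorem append_assoc (σ τ ρ : TSeq.{u} A) :
    (σ.append τ).append ρ = σ.append (τ.append ρ) := by
  refine ext_of_val (add_assoc _ _ _) fun i hi hj => ?_
  obtain hlt | hle := lt_or_ge i σ.len
  · have hlt' : i < (σ.append τ).len := hlt.trans_le le_self_add
    rw [append_val_of_lt _ _ hlt', append_val_of_lt _ _ hlt, append_val_of_lt _ _ hlt]
  · obtain ⟨j, rfl⟩ := exists_add_of_le hle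
    have hj' : j < (τ.append ρ).len := (add_lt_add_iff_left σ.len).1 hj
    rw [append_val_add σ (τ.append ρ) hj']
    obtain hlt | hle := lt_or_ge j τ.len
    · have hlt' : σ.len + j < (σ.append τ).len := (add_lt_add_iff_left σ.len).2 hlt
      rw [append_val_of_lt _ _ hlt', append_val_add _ _ hlt, append_val_of_lt _ _ hlt]
    · obtain ⟨k, rfl⟩ := exists_add_of_le hle
      have hk : k < ρ.len := (add_lt_add_iff_left τ.len).1 hj'
      rw [append_val_add _ _ hk]
      exact append_val_of_eq_add (σ.append τ) ρ (add_assoc _ _ _).symm hk hi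

theorem append_single_val (σ : TSeq.{u} A) (a : A) (hi : σ.len < (σ.append (single a)).len) :
    (σ.append (single a)).val ⟨σ.len, hi⟩ = a :=
  append_val_of_eq_add σ (single a) (add_zero _).symm (zero_lt_one' Ordinal) hi

theorem exists_isUnion {ι : Type w} [LinearOrder ι] [Small.{u} ι] (s : ι → TSeq.{u} A)
    (hs : Monotone s) : ∃ ρ, IsUnion s ρ := by
  have hex : ∀ j : Set.Iio (⨆ i, (s i).len), ∃ i, j.1 < (s i).len := fun j =>
    Ordinal.lt_iSup_iff.1 j.2
  choose k hk using hex
  refine ⟨⟨⨆ i, (s i).len, fun j => (s (k j)).val ⟨j.1, hk j⟩⟩,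
    fun i => ⟨Ordinal.le_iSup (fun i => (s i).len) i, fun j hi hj => ?_⟩,
    fun j hj => ⟨k ⟨j, hj⟩, hk ⟨j, hj⟩⟩⟩
  obtain h | h := le_total i (k ⟨j, hj⟩)
  · exact (hs h).2 j hi (hk ⟨j, hj⟩)
  · exact ((hs h).2 j (hk ⟨j, hj⟩) hi).symm

end TSeq

theorem IsLimitClosed.isUnion_nat_mem {A : Type v} {δ : Ordinal.{u}} {T : Set (TSeq.{u} A)}
    (hT : IsLimitClosed δ T) (hδ : ω < δ) {ρ : ℕ → TSeq.{u} A} (hρ : Monotone ρ)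
    (hmem : ∀ n, ρ n ∈ T) {U : TSeq.{u} A} (hU : TSeq.IsUnion ρ U) : U ∈ T := by
  have hex : ∀ i : Set.Iio (ω : Ordinal.{u}), ∃ n : ℕ, i.1 = n := fun i => Ordinal.lt_omega0.1 i.2
  choose k hk using hex
  refine hT ω Ordinal.isSuccLimit_omega0 hδ (fun i => ρ (k i)) (fun i j hij => hρ ?_)
    (fun i => hmem _) U ⟨fun i => hU.1 _, fun j hj => ?_⟩
  · have h : i.1 ≤ j.1 := hij
    rw [hk i, hk j] at h
    exact_mod_cast h
  · obtain ⟨n, hn⟩ := hU.2 j hj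
    let m : Set.Iio (ω : Ordinal.{u}) := ⟨n, Ordinal.natCast_lt_omega0 n⟩
    have hkn : n = k m := Nat.cast_injective (R := Ordinal.{u}) (hk m)
    exact ⟨m, hn.trans_eq (congrArg (fun n => (ρ n).len) hkn)⟩

/-! ### Branches through the splitting part of a tree -/

section Branch

variable {κ : Cardinal.{u}}

/-- `G` consists of the nodes above the stem of a short Laver tree inside `T`. -/
theorem IsPseudoLaverTree.exists_splitting {T : Set (TSeq.{u} (Pt κ))}
    (hT : IsPseudoLaverTree κ T) : ∃ G ⊆ T, G.Nonempty ∧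
      ∀ σ ∈ G, #(succSet G σ) = Cardinal.lift.{u + 1} κ := by
  obtain ⟨σ₀, hσ₀⟩ := hT.isTree.nonempty
  obtain ⟨τ, -, -, hL, s, hs, hsucc⟩ := hT.exists_short σ₀ hσ₀
  refine ⟨(fun ρ => τ.append ρ) '' {ρ | ρ ∈ omegaPart T τ ∧ s ≤ ρ}, ?_,
    ⟨_, s, ⟨hs.1.1, le_rfl⟩, rfl⟩, ?_⟩
  · rintro _ ⟨ρ, ⟨hρ, -⟩, rfl⟩
    exact hρ.2
  · rintro _ ⟨ρ, ⟨hρ, hsρ⟩, rfl⟩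
    refine le_antisymm ((Cardinal.mk_set_le _).trans_eq ?_) ?_
    · rw [Cardinal.mk_Iio_ordinal, Cardinal.card_ord]
    · rw [← hsucc ρ hρ hsρ]
      refine Cardinal.mk_le_mk_of_subset fun a ha => ?_
      exact ⟨ρ.append (TSeq.single a), ⟨ha, hsρ.trans (TSeq.le_append _ _)⟩,
        (TSeq.append_assoc _ _ _).symm⟩

/-- Append the entries of `l`, from last to first, to `τ`. -/
noncomputable def appendList (τ : TSeq.{u} (Pt κ)) (l : List (Pt κ)) : TSeq.{u} (Pt κ) :=
  l.foldr (fun a σ => σ.append (TSeq.single a)) τ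

theorem exists_mem_ge_of_mk_eq {S : Set (Pt κ)}
    (hS : #S = Cardinal.lift.{u + 1} κ) {β : Ordinal.{u}} (hβ : β < κ.ord) :
    ∃ a ∈ S, β ≤ a.1 := by
  by_contra! hlt
  have hinj : Function.Injective fun a : S => (⟨a.1.1, hlt _ a.2⟩ : Set.Iio β) := fun a b hab =>
    Subtype.ext (Subtype.ext (congrArg (fun c : Set.Iio β => c.1) hab))
  have hle := Cardinal.mk_le_of_injective hinj
  rw [hS, Cardinal.mk_Iio_ordinal, Cardinal.lift_le] at hle
  exact hle.not_gt (Cardinal.lt_ord.1 hβ)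

/-- There are fewer than `κ` finite lists of entries below `β`, so one bound covers a chosen next
entry for each. -/
theorem exists_closing_function (hreg : κ.IsRegular) (hunc : Cardinal.aleph0 < κ)
    {G : Set (TSeq.{u} (Pt κ))} (hG : ∀ σ ∈ G, #(succSet G σ) = Cardinal.lift.{u + 1} κ)
    (τ : TSeq.{u} (Pt κ)) :
    ∃ f : Ordinal.{u} → Ordinal.{u}, (∀ β < κ.ord, f β < κ.ord) ∧
      ∀ β < κ.ord, ∀ l : List (Pt κ), (∀ a ∈ l, a.1 < β) → appendList τ l ∈ G →
        ∃ a : Pt κ, β ≤ a.1 ∧ a.1 < f β ∧ appendList τ (a :: l) ∈ G := by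
  have hex : ∀ β : Ordinal.{u}, ∃ b : Ordinal.{u}, β < κ.ord → b < κ.ord ∧
      ∀ l : List (Pt κ), (∀ a ∈ l, a.1 < β) → appendList τ l ∈ G →
        ∃ a : Pt κ, β ≤ a.1 ∧ a.1 < b ∧ appendList τ (a :: l) ∈ G := by
    intro β
    by_cases hβ : β < κ.ord
    · have hnext : ∀ l : List (Pt κ), ∃ a : Pt κ, appendList τ l ∈ G →
          β ≤ a.1 ∧ appendList τ (a :: l) ∈ G := by
        intro l
        by_cases hl : appendList τ l ∈ G
        · obtain ⟨a, ha, hle⟩ := exists_mem_ge_of_mk_eq (hG _ hl) hβ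
          exact ⟨a, fun _ => ⟨hle, ha⟩⟩
        · exact ⟨⟨β, hβ⟩, fun h => absurd h hl⟩
      choose x hx using hnext
      let e : Set.Iio β → Pt κ := fun a => ⟨a.1, a.2.trans hβ⟩
      obtain ⟨b, hb, hxb⟩ := exists_lt_ord_forall_lt hreg (ι := List (Set.Iio β))
        (f := fun l => (x (l.map e)).1)
        (by
          rw [Cardinal.lift_id'.{u, u + 1}]
          refine (Cardinal.mk_list_le_max _).trans_lt (max_lt (by simpa using hunc) ?_)
          rw [Cardinal.mk_Iio_ordinal, Cardinal.lift_lt]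
          exact Cardinal.lt_ord.1 hβ)
        fun l => (x _).2
      refine ⟨b, fun _ => ⟨hb, fun l hl hlG => ⟨x l, (hx l hlG).1, ?_, (hx l hlG).2⟩⟩⟩
      have hmap : ∃ m : List (Set.Iio β), m.map e = l := by
        refine ⟨l.attach.map fun a => ⟨a.1.1, hl _ a.2⟩, ?_⟩
        rw [List.map_map]
        exact List.attach_map_subtype_val l
      obtain ⟨m, rfl⟩ := hmap
      exact hxb m
    · exact ⟨0, fun h => absurd h hβ⟩
  choose f hf using hex
  exact ⟨f, fun β hβ => (hf β hβ).1, fun β hβ => (hf β hβ).2⟩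

/-- At a closure point `α` with a ladder, there is a branch whose entries converge to `α`. -/
theorem exists_branch {G : Set (TSeq.{u} (Pt κ))} {τ : TSeq.{u} (Pt κ)} (hτ : τ ∈ G)
    {f : Ordinal.{u} → Ordinal.{u}}
    (hf : ∀ β < κ.ord, ∀ l : List (Pt κ), (∀ a ∈ l, a.1 < β) → appendList τ l ∈ G →
        ∃ a : Pt κ, β ≤ a.1 ∧ a.1 < f β ∧ appendList τ (a :: l) ∈ G)
    {α : Ordinal.{u}} (hακ : α < κ.ord) (hα : ∀ β < α, f β < α)
    (hα' : ∀ β < α, β + 1 < α) {a : ℕ → Ordinal.{u}} (ha : ∀ n, a n < α) :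
    ∃ (x : ℕ → Pt κ) (ρ : ℕ → TSeq.{u} (Pt κ)), ρ 0 = τ ∧
      (∀ n, ρ (n + 1) = (ρ n).append (TSeq.single (x n))) ∧ (∀ n, ρ n ∈ G) ∧
      (∀ n, a n ≤ (x n).1) ∧ (∀ n, (x n).1 < α) ∧ ∀ m n, m < n → (x m).1 < (x n).1 := by
  -- Finitely many entries below `α` have a strict bound below `α`, because `α` is closed under
  -- successor.
  have hbd : ∀ l : List (Pt κ), (∀ y ∈ l, y.1 < α) → ∀ γ < α, ∃ β < α, γ ≤ β ∧
      ∀ y ∈ l, y.1 < β := by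
    intro l
    induction l with
    | nil => exact fun _ γ hγ => ⟨γ, hγ, le_rfl, by simp⟩
    | cons z l ih =>
      intro hl γ hγ
      obtain ⟨β, hβ, hγβ, h⟩ := ih (fun y hy => hl y (List.mem_cons_of_mem _ hy)) γ hγ
      refine ⟨max β (z.1 + 1), max_lt hβ (hα' _ (hl z List.mem_cons_self)),
        hγβ.trans (le_max_left _ _), fun y hy => ?_⟩
      obtain rfl | hy := List.mem_cons.1 hy
      · exact (lt_add_one _).trans_le (le_max_right _ _)
      · exact (h y hy).trans_le (le_max_left _ _)
  -- The next entry is pushed above `a n` and all earlier entries, while closure under `f` keeps it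
  -- below `α`.
  have hstep : ∀ (n : ℕ) (l : {l : List (Pt κ) // (∀ y ∈ l, y.1 < α) ∧ appendList τ l ∈ G}),
      ∃ z : Pt κ, ((∀ y ∈ z :: l.1, y.1 < α) ∧ appendList τ (z :: l.1) ∈ G) ∧ a n ≤ z.1 ∧
        ∀ y ∈ l.1, y.1 < z.1 := by
    rintro n ⟨l, hl, hlG⟩
    obtain ⟨β, hβ, haβ, h⟩ := hbd l hl (a n) (ha n)
    obtain ⟨z, hz, hzf, hzG⟩ := hf β (hβ.trans hακ) l h hlG
    refine ⟨z, ⟨fun y hy => ?_, hzG⟩, haβ.trans hz, fun y hy => (h y hy).trans_le hz⟩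
    obtain rfl | hy := List.mem_cons.1 hy
    · exact hzf.trans (hα β hβ)
    · exact hl y hy
  choose z hz₁ hz₂ hz₃ using hstep
  let S : ℕ → {l : List (Pt κ) // (∀ y ∈ l, y.1 < α) ∧ appendList τ l ∈ G} := fun n =>
    Nat.rec ⟨[], by simp, hτ⟩ (fun n l => ⟨z n l :: l.1, hz₁ n l⟩) n
  have hS : ∀ n, (S (n + 1)).1 = z n (S n) :: (S n).1 := fun n => rfl
  have hmem : ∀ m n, m < n → z m (S m) ∈ (S n).1 := by
    intro m n hmn
    induction n, hmn using Nat.le_induction with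
    | base => rw [hS]; exact List.mem_cons_self
    | succ n _ ih => rw [hS]; exact List.mem_cons_of_mem _ ih
  refine ⟨fun n => z n (S n), fun n => appendList τ (S n).1, rfl, fun n => ?_,
    fun n => (S n).2.2, fun n => hz₂ n (S n), fun n => ?_, fun m n hmn => ?_⟩
  · exact congrArg (appendList τ) (hS n)
  · exact (hz₁ n (S n)).1 _ List.mem_cons_self
  · exact hz₃ n (S n) _ (hmem m n hmn)

/-- The ladder makes the entries cofinal in `α`. Every position strictly between the start and the
end is a successor, so it carries no limit. -/
theorem isLim_union {x : ℕ → Pt κ} {ρ : ℕ → TSeq.{u} (Pt κ)}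
    (hρ : ∀ n, ρ (n + 1) = (ρ n).append (TSeq.single (x n))) {a : ℕ → Ordinal.{u}}
    {α : Ordinal.{u}} (ha : IsLadder a α) (hax : ∀ n, a n ≤ (x n).1) (hxα : ∀ n, (x n).1 < α)
    (hx : ∀ m n, m < n → (x m).1 < (x n).1) {U : TSeq.{u} (Pt κ)} (hU : TSeq.IsUnion ρ U) :
    IsLim U U.len α ∧ ∀ μ α', (ρ 0).len < μ → μ < U.len → ¬ IsLim U μ α' := by
  have hlen : ∀ n, (ρ (n + 1)).len = (ρ n).len + 1 := fun n => by rw [hρ]; rfl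
  have hmono : StrictMono fun n => (ρ n).len := strictMono_nat_of_lt_succ fun n => by
    rw [hlen]
    exact lt_add_one _
  have hltU : ∀ n, (ρ n).len < U.len := fun n => (hmono n.lt_succ_self).trans_le (hU.1 _).1
  have hidx : ∀ i, (ρ 0).len ≤ i → ∀ hi : i < U.len, ∃ k, i = (ρ k).len ∧
      U.val ⟨i, hi⟩ = x k := by
    intro i h0 hi
    classical
    have hex := hU.2 i hi
    obtain ⟨k, hk⟩ : ∃ k, Nat.find hex = k + 1 := by
      refine Nat.exists_eq_succ_of_ne_zero fun hz => ?_
      have := Nat.find_spec hex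
      rw [hz] at this
      exact this.not_ge h0
    have h₁ : i < (ρ (k + 1)).len := hk ▸ Nat.find_spec hex
    have h₂ : (ρ k).len ≤ i := not_lt.1 (Nat.find_min hex (by omega))
    have h₃ : i = (ρ k).len := by
      rw [hlen] at h₁
      exact le_antisymm (Order.lt_add_one_iff.1 h₁) h₂
    refine ⟨k, h₃, ?_⟩
    subst h₃
    rw [← (hU.1 (k + 1)).2 _ h₁ hi]
    have hval : ∀ (σ : TSeq.{u} (Pt κ)) (_ : σ = (ρ k).append (TSeq.single (x k)))
        (hi : (ρ k).len < σ.len), σ.val ⟨(ρ k).len, hi⟩ = x k := by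
      rintro _ rfl hi
      exact TSeq.append_single_val _ _ _
    exact hval _ (hρ k) h₁
  refine ⟨⟨le_rfl, fun γ hγ => ?_, (ρ 0).len, hltU 0, fun i hi hle _ => ?_⟩,
    fun μ α' h0 hμ => ?_⟩
  · obtain ⟨n, hn⟩ := ha.2 γ hγ
    refine ⟨(ρ (n + 1)).len, hltU _, fun i hi hle _ => ?_⟩
    obtain ⟨k, rfl, hk⟩ := hidx i ((hmono.monotone (Nat.zero_le _)).trans hle) hi
    rw [hk]
    exact (hn.trans (hax n)).trans_lt (hx n k (hmono.le_iff_le.1 hle))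
  · obtain ⟨k, -, hk⟩ := hidx i hle hi
    rw [hk]
    exact hxα k
  · obtain ⟨k, rfl, -⟩ := hidx μ h0.le hμ
    obtain ⟨m, rfl⟩ := Nat.exists_eq_succ_of_ne_zero (hmono.lt_iff_lt.1 h0).ne'
    rw [Nat.succ_eq_add_one, hlen]
    exact not_isLim_add_one _ _ _

end Branch

/-! ### Meeting dense sets and the Cohen name -/

theorem IsPseudoLaverTree.exists_decode_mem {κ : Cardinal.{u}} (hreg : κ.IsRegular)
    (hunc : Cardinal.aleph0 < κ) {h : Ordinal.{u} → TSeq.{u} Bool} (hh : IsGuessing κ h)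
    {T : Set (TSeq.{u} (Pt κ))} (hT : IsPseudoLaverTree κ T) {D : Set (TSeq.{u} Bool)}
    (hD : IsCohenDense κ D) :
    ∃ τ ∈ T, ∃ t ∈ D, ∀ (i : Ordinal.{u}) (hi : i < t.len), Decode h τ i (t.val ⟨i, hi⟩) := by
  obtain ⟨G, hGT, ⟨τ, hτ⟩, hG⟩ := hT.exists_splitting
  obtain ⟨s, hs, hs₁, hs₂⟩ := exists_decoded_bound hreg hh.len_lt
    (hT.isTree.len_lt τ (hGT hτ))
  obtain ⟨t, ht, hst⟩ := hD.2 s hs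
  obtain ⟨f, hf, hfG⟩ := exists_closing_function hreg hunc hG τ
  -- Successor ordinals also have ladders in the present sense; the term `β + 1` excludes them.
  obtain ⟨α, ⟨⟨a, ha⟩, rfl⟩, hακ, hα⟩ := hh.isStat t (hD.1 ht) (fun β => max (f β) (β + 1))
    fun β hβ => max_lt (hf β hβ) (add_one_lt_ord hreg hβ)
  obtain ⟨x, ρ, hρ₀, hρ, hρG, hax, hxα, hx⟩ := exists_branch hτ hfG hακ
    (fun β hβ => (le_max_left _ _).trans_lt (hα β hβ))
    (fun β hβ => (le_max_right _ _).trans_lt (hα β hβ)) ha.1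
  have hmono : Monotone ρ := monotone_nat_of_le_succ fun n => by
    rw [hρ]
    exact TSeq.le_append _ _
  obtain ⟨U, hU⟩ := TSeq.exists_isUnion ρ hmono
  obtain ⟨hlim, hno⟩ := isLim_union hρ ha hax hxα hx hU
  have hω : ω < κ.ord := by rwa [Cardinal.lt_ord, Ordinal.card_omega0]
  subst hρ₀
  exact ⟨U, hT.limitClosed.isUnion_nat_mem hω hmono (fun n => hGT (hρG n)) hU, _, ht,
    decode_of_isLim_len (hU.1 0) hs₁ hs₂ hlim hst hno⟩

theorem isCohenDense_lt_len {κ : Cardinal.{u}} (hreg : κ.IsRegular) {i : Ordinal.{u}}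
    (hi : i < κ.ord) : IsCohenDense κ {t | t.len < κ.ord ∧ i < t.len} := by
  refine ⟨fun t ht => ht.1, fun s hs => ?_⟩
  refine ⟨s.append ⟨i + 1, fun _ => true⟩, ⟨?_, ?_⟩, TSeq.le_append _ _⟩
  · exact Ordinal.isPrincipal_add_ord hreg.aleph0_le hs (add_one_lt_ord hreg hi)
  · exact (lt_add_one i).trans_le le_add_self

/-- The name for the binary sequence decoded from the generic branch. -/
def decodeName {κ : Cardinal.{u}} (h : Ordinal.{u} → TSeq.{u} Bool)
    (ℙ : Set (Set (TSeq.{u} (Pt κ)))) : SubsetName (Pt κ × Bool) ℙ :=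
  {x | ∀ τ ∈ x.2.1, ∀ b, Decode h τ x.1.1.1 b → b = x.1.2}

end KLaver

theorem theorem3p7 (κ : Cardinal.{u}) (hreg : κ.IsRegular) (hunc : Cardinal.aleph0 < κ)
    (hpow : Cardinal.powerlt κ κ = κ)
    -- a forcing notion whose conditions are pseudo-Laver trees, ordered by inclusion
    (ℙ : Set (Set (KLaver.TSeq.{u} (KLaver.Pt κ))))
    (hℙ : ∀ T ∈ ℙ, KLaver.IsPseudoLaverTree κ T)
    (hres : ∀ T ∈ ℙ, ∀ σ ∈ T, KLaver.restrictTo T σ ∈ ℙ) :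
    KLaver.AddsCohenReal κ (↥ℙ) := by
  obtain ⟨h, hh⟩ := KLaver.exists_isGuessing hreg hunc hpow
  have hdense : ∀ p : ℙ, ∀ D : Set (KLaver.TSeq.{u} Bool), KLaver.IsCohenDense κ D →
      KLaver.ForcesExists D (fun t => KLaver.ForcesInitial κ (KLaver.decodeName h ℙ) t) p := by
    rintro p D hD ⟨T, hTℙ⟩ -
    obtain ⟨τ, hτ, t, ht, hdec⟩ := (hℙ T hTℙ).exists_decode_mem hreg hunc hh hD
    -- All nodes of `T ↑ τ` are comparable with `τ`, so they can decode no bit that disagrees with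
    -- `t`.
    refine ⟨⟨_, hres T hTℙ τ hτ⟩, fun σ hσ => hσ.1, t, ht, fun i hi q hq => ⟨q, le_rfl,
      ⟨_, hres T hTℙ τ hτ⟩, fun σ hσ b hb => ?_, hq⟩⟩
    obtain hle | hle := hσ.2
    · exact hb.unique ((hdec i.1 hi).mono hle)
    · exact (hb.mono hle).unique (hdec i.1 hi)
  refine ⟨KLaver.decodeName h ℙ, fun p => ⟨⟨fun i q hq => ?_, ?_⟩, hdense p⟩⟩
  · obtain ⟨r, hr, t, ht, hrt⟩ := hdense p _ (KLaver.isCohenDense_lt_len hreg i.2) q hq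
    exact ⟨r, hr, _, Set.mem_univ _, hrt i ht.2⟩
  · rintro i y z hyz q - ⟨hy, hz⟩
    obtain ⟨r, hr, s, hs, hrs⟩ := hy q le_rfl
    obtain ⟨r', hr', s', hs', hrs'⟩ := hz r hr
    obtain ⟨τ, hτ, t, ht, hdec⟩ := (hℙ r'.1 r'.2).exists_decode_mem hreg hunc hh
      (KLaver.isCohenDense_lt_len hreg i.2)
    have hd := hdec i.1 ht.2
    exact hyz ((hs τ (hrs (hr' hτ)) _ hd).symm.trans (hs' τ (hrs' hτ) _ hd))
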